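/- Let $F$ be a field with $\operatorname{char} F \neq 2$ and let $\overline F$ be its algebraic closure. Let $V$ be a $5$-dimensional vector space over $F$ with a basis $E=(e_1,\dots,e_5)$, let $\chi$ be a non-singular quadratic form on $V$ of Witt index $2$ (so that its singular points and totally singular lines form the generalized quadrangle $Q(4,F)$), and let $\varphi(x,y)=\chi(x+y)-\chi(x)-\chi(y)$ be its bilinearization, a symmetric bilinear form. Let $\mathcal G_\varphi\subseteq \mathrm{PG}(V\wedge V)$ be the set of points $[x\wedge y]$ for which $\langle x,y\rangle$ is a $2$-dimensional subspace of $V$ that is totally isotropic for $\varphi$; it is a subset of the line Grassmannian $\mathcal G$ of all points $[x\wedge y]$ with $\dim\langle x,y\rangle=2$. Let $\mathcal V\subset \mathrm{PG}(9,F)$ be the Veronese variety of $\mathrm{PG}(3,F)$, that is, the set of points $[(x_ix_j)_{1\le i\le j\le 4}]$ with $0\neq x\in F^4$. Let $\overline{\mathcal V}$, $\overline{\mathcal G}$ and $\overline{\mathcal G}_\varphi$ be the sets obtained by the same definitions over $\overline F$, from $\overline F^4$, from $\overline V=\overline F\otimes_F V$, and from $\overline V$ with the $\overline F$-bilinear extension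 of $\varphi$, respectively. Then $\mathcal V$ and $\mathcal G_\varphi$ are isomorphic as algebraic varieties over $F$. More precisely, $\overline{\mathcal V}$ and $\overline{\mathcal G}_\varphi\subseteq\overline{\mathcal G}$ are projective algebraic sets defined by homogeneous polynomials with coefficients in $F$ (in the coordinates $x_{i,j}$, respectively the coordinates with respect to the vectors $e_i\wedge e_j$, $i<j$), and there is an $F$-linear isomorphism $\pi: F^{10}\to V\wedge V$ that maps $\mathcal V$ onto $\mathcal G_\varphi$ and whose $\overline F$-linear extension induces an isomorphism of algebraic varieties, defined over $F$, from $\overline{\mathcal V}$ onto $\overline{\mathcal G}_\varphi$ (that is, a bijection which, together with its inverse, is given locally by homogeneous polynomials of equal degree with coefficients in $F$). -/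

import Mathlib

open scoped LinearAlgebra.Projectivization TensorProduct

namespace VeroneseGrassmann

noncomputable section

/-! ### Projective algebraic sets and their isomorphisms

`W` is a `K`-vector space with a basis `b`, and `F` is a subfield of `K`. The points of `PG(W)` have
homogeneous coordinates with respect to `b`, and "defined over `F`" means: given by polynomials in
these coordinates with coefficients in `F`. -/

section Varieties

variable (F : Type*) {K : Type*} [Field F] [Field K] [Algebra F K]
variable {ι W κ W' : Type*} [AddCommGroup W] [Module K W] [AddCommGroup W'] [Module K W']

/-- The value of a polynomial `P` with coefficients in `F` at homogeneous coordinates of the point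
`p`. For homogeneous `P`, another choice of coordinates changes it by a non-zero factor, which for
homogeneous polynomials of the same degree is the same. -/
def evalAt {F : Type*} [Field F] [Algebra F K] (b : Module.Basis ι K W) (p : ℙ K W)
    (P : MvPolynomial ι F) : K :=
  MvPolynomial.aeval (fun i => b.repr p.rep i) P

/-- `X` is a projective algebraic set defined by homogeneous equations over `F`. -/
def IsAlgebraicSet (b : Module.Basis ι K W) (X : Set (ℙ K W)) : Prop :=
  ∃ T : Set (MvPolynomial ι F), (∀ P ∈ T, ∃ d : ℕ, P.IsHomogeneous d) ∧
    X = {p | ∀ P ∈ T, evalAt b p P = 0}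

/-- `f : X → Y` is a regular map (morphism of varieties) defined over `F`: around every point of `X`
the homogeneous coordinates of `f q` are homogeneous polynomials of one common degree, with
coefficients in `F` and without a common zero there, in the homogeneous coordinates of `q`. -/
def IsRegularMap (b : Module.Basis ι K W) (b' : Module.Basis κ K W')
    {X : Set (ℙ K W)} {Y : Set (ℙ K W')} (f : X → Y) : Prop :=
  ∀ p : X, ∃ (d : ℕ) (P : κ → MvPolynomial ι F),
    (∀ k, (P k).IsHomogeneous d) ∧
    (∃ k, evalAt b p.1 (P k) ≠ 0) ∧
    ∀ q : X, (∃ k, evalAt b q.1 (P k) ≠ 0) →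
      ∃ c : K, c ≠ 0 ∧ ∀ k, b'.repr (f q).1.rep k = c * evalAt b q.1 (P k)

/-- `X` and `Y` are projective algebraic sets defined over `F`, and the bijection `f` is an
isomorphism of varieties, defined over `F`, between them. -/
structure IsVarietyIso (b : Module.Basis ι K W) (b' : Module.Basis κ K W')
    (X : Set (ℙ K W)) (Y : Set (ℙ K W')) (f : X ≃ Y) : Prop where
  source_algebraic : IsAlgebraicSet F b X
  target_algebraic : IsAlgebraicSet F b' Y
  regular : IsRegularMap F b b' f
  regular_symm : IsRegularMap F b' b f.symm

/-- The `K`-linear map `πK` is the scalar extension of the `F`-linear map `π`: both have the same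
matrix with respect to the given bases. -/
def IsScalarExtension {F : Type*} [Field F] [Algebra F K]
    {W₀ W₀' : Type*} [AddCommGroup W₀] [Module F W₀] [AddCommGroup W₀'] [Module F W₀']
    (b₀ : Module.Basis ι F W₀) (b₀' : Module.Basis κ F W₀')
    (b : Module.Basis ι K W) (b' : Module.Basis κ K W')
    (π : W₀ →ₗ[F] W₀') (πK : W →ₗ[K] W') : Prop :=
  ∀ i k, b'.repr (πK (b i)) k = algebraMap F K (b₀'.repr (π (b₀ i)) k)

end Varieties

/-! ### The Veronese variety -/

section Veronese

variable (K : Type*) [Field K] (n : ℕ)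

/-- The quadratic veronesean map on `V(n,K)`: the coordinate of `x` at the unordered pair `{i, j}`,
where `i = j` is allowed, is `x i * x j`. -/
def veroneseMap (x : Fin n → K) : Sym2 (Fin n) → K :=
  fun s => (s.map x).mul

/-- The Veronese variety of `PG(n-1,K)`: the points `[veroneseMap x]`, `[x]` a point. -/
def veroneseVariety : Set (ℙ K (Sym2 (Fin n) → K)) :=
  {p | ∃ x : Fin n → K, x ≠ 0 ∧ p.submodule = Submodule.span K {veroneseMap K n x}}

end Veronese

/-! ### Sets of lines in the line Grassmannian -/

section Grassmann

variable {K V : Type*} [Field K] [AddCommGroup V] [Module K V]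

/-- The image of a set of lines of `PG(V)` under the map sending the line `⟨x, y⟩` to the point
`[x ∧ y]` of `PG(V ∧ V)`. -/
def grassmannImage (L : Set (Submodule K V)) : Set (ℙ K (⋀[K]^2 V)) :=
  {p | ∃ S ∈ L, ∃ x y : V, S = Submodule.span K {x, y} ∧
    p.submodule = Submodule.span K {exteriorPower.ιMulti K 2 ![x, y]}}

variable (K V) in
/-- The line Grassmannian of `PG(V)`. -/
def lineGrassmannian : Set (ℙ K (⋀[K]^2 V)) :=
  grassmannImage {S : Submodule K V | Module.finrank K S = 2}

/-- The lines of `PG(V)` that are totally isotropic for `φ`. -/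
def isotropicLines (φ : LinearMap.BilinForm K V) : Set (Submodule K V) :=
  {S | Module.finrank K S = 2 ∧ ∀ u ∈ S, ∀ v ∈ S, φ u v = 0}

/-- The subset of the line Grassmannian formed by the totally isotropic lines of `φ`. -/
def phiSubset (φ : LinearMap.BilinForm K V) : Set (ℙ K (⋀[K]^2 V)) :=
  grassmannImage (isotropicLines φ)

/-- A quadratic form is non-singular if it has no non-zero singular vector in the radical of its
bilinearization. -/
def IsNonsingular (χ : QuadraticForm K V) : Prop :=
  ∀ x : V, x ≠ 0 → (∀ y : V, QuadraticMap.polar χ x y = 0) → χ x ≠ 0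

/-- `χ` has Witt index `m`: the largest dimension of a totally singular subspace is `m`. -/
def HasWittIndex (χ : QuadraticForm K V) (m : ℕ) : Prop :=
  IsGreatest {d : ℕ | ∃ S : Submodule K V, (∀ x ∈ S, χ x = 0) ∧ Module.finrank K S = d} m

end Grassmann

end

end VeroneseGrassmann

namespace VeroneseGrassmann

/-! ### Linear bijections with matrix over the subfield as morphisms -/

section LinearMorphisms

variable {F K : Type*} [Field F] [Field K] [Algebra F K]
variable {ι W κ W' : Type*} [AddCommGroup W] [Module K W] [AddCommGroup W'] [Module K W']
variable {W₀ W₀' : Type*} [AddCommGroup W₀] [Module F W₀] [AddCommGroup W₀'] [Module F W₀']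

/-! The lines of the quadric `Q(4,K)` correspond to the points of `PG(3,K)`, and in suitable
coordinates this correspondence is quadratic: for the form `x₀x₂ + x₁x₃ - x₄²`, up to a scalar, the
line belonging to the point `x` has as Plücker coordinates, up to sign, the eight monomials `xᵢxⱼ`
other than `x₀x₁` and `x₂x₃`, together with `x₀x₁ ± x₂x₃`. These are linear in the Veronese
coordinates, and since 2 is invertible they determine them, so the correspondence is the restriction
of a linear bijection `bivectorEquiv` of the ambient ten-dimensional spaces.

That this bijection carries the Veronese variety onto the set of isotropic lines
(`IsSplitBasis.image_veroneseVariety`) is a computation over any field with 2 ≠ 0. In one direction,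
two points spanning the line are read off from its skew Plücker matrix
(`exists_wedge_lineVector_eq_smul`); in the other, the Plücker coordinates of an isotropic line
satisfy the quadrics defining the Veronese variety
(`IsSplitBasis.mul_eq_mul_of_bivectorMap_eq_wedge`).

The hypotheses on the form provide a basis with this Gram matrix, up to a scalar, already over `F`
(`exists_isSplitBasis`). The computation then applies over `F` and over its closure with the same
matrix. A linear bijection with entries in `F` is regular in both directions and transports
equations over `F`, so the equations of the Veronese variety suffice. -/

theorem aeval_mul_of_isHomogeneous {P : MvPolynomial ι F} {d : ℕ} (hP : P.IsHomogeneous d)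
    (c : K) (x : ι → K) :
    MvPolynomial.aeval (fun i => c * x i) P = c ^ d * MvPolynomial.aeval x P := by
  rw [MvPolynomial.aeval_def, MvPolynomial.aeval_def, MvPolynomial.eval₂_eq,
    MvPolynomial.eval₂_eq, Finset.mul_sum]
  refine Finset.sum_congr rfl fun m hm => ?_
  have hd : ∑ i ∈ m.support, m i = d := by
    have := hP (MvPolynomial.mem_support_iff.mp hm)
    simpa only [Finsupp.weight_apply, Finsupp.sum, Pi.one_apply, smul_eq_mul, mul_one] using this
  simp only [mul_pow, Finset.prod_mul_distrib, Finset.prod_pow_eq_pow_sum, hd]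
  ring

/-- The representative of the image of a point under a linear bijection. -/
theorem exists_rep_map_eq (e : W ≃ₗ[K] W') (p : ℙ K W) :
    ∃ c : K, c ≠ 0 ∧
      (Projectivization.map e.toLinearMap e.injective p).rep = c • e p.rep := by
  have h0 : e.toLinearMap p.rep ≠ 0 := by
    simpa using p.rep_nonzero
  obtain ⟨a, ha⟩ := Projectivization.exists_smul_eq_mk_rep K (e.toLinearMap p.rep) h0
  refine ⟨a, a.ne_zero, ?_⟩
  conv_lhs => rw [← p.mk_rep, Projectivization.map_mk]
  rw [← ha]
  rfl

theorem map_map_symm (e : W ≃ₗ[K] W') (p : ℙ K W') :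
    Projectivization.map e.toLinearMap e.injective
      (Projectivization.map e.symm.toLinearMap e.symm.injective p) = p := by
  induction p using Projectivization.ind with
  | h v hv => simp [Projectivization.map_mk]

theorem map_symm_map (e : W ≃ₗ[K] W') (p : ℙ K W) :
    Projectivization.map e.symm.toLinearMap e.symm.injective
      (Projectivization.map e.toLinearMap e.injective p) = p :=
  map_map_symm e.symm p

section ScalarExtension

variable [Fintype ι]
variable {b₀ : Module.Basis ι F W₀} {b₀' : Module.Basis κ F W₀'}
variable {b : Module.Basis ι K W} {b' : Module.Basis κ K W'}

/-- The coordinates of the image under `π` as linear polynomials. -/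
noncomputable def coordPoly (b₀ : Module.Basis ι F W₀) (b₀' : Module.Basis κ F W₀')
    (π : W₀ →ₗ[F] W₀') (k : κ) : MvPolynomial ι F :=
  ∑ i, MvPolynomial.C (b₀'.repr (π (b₀ i)) k) * MvPolynomial.X i

theorem coordPoly_isHomogeneous (π : W₀ →ₗ[F] W₀') (k : κ) :
    (coordPoly b₀ b₀' π k).IsHomogeneous 1 :=
  MvPolynomial.IsHomogeneous.sum _ _ _ fun _ _ => MvPolynomial.isHomogeneous_C_mul_X _ _

theorem IsScalarExtension.aeval_coordPoly {π : W₀ →ₗ[F] W₀'} {πK : W →ₗ[K] W'}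
    (h : IsScalarExtension b₀ b₀' b b' π πK) (w : W) (k : κ) :
    MvPolynomial.aeval (fun i => b.repr w i) (coordPoly b₀ b₀' π k) = b'.repr (πK w) k := by
  conv_rhs => rw [← b.sum_repr w]
  simp only [coordPoly, map_sum, map_mul, MvPolynomial.aeval_C, MvPolynomial.aeval_X, map_smul,
    Finsupp.coe_finsetSum, Finset.sum_apply, Finsupp.smul_apply, smul_eq_mul, h _ k]
  exact Finset.sum_congr rfl fun i _ => mul_comm _ _

/-- Extending scalars in the matrix identity for `π` and its inverse gives a right inverse of the
matrix of `πK`; it must equal the left inverse, which is the matrix of `πK.symm`. -/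
theorem IsScalarExtension.symm [Fintype κ] {π : W₀ ≃ₗ[F] W₀'} {πK : W ≃ₗ[K] W'}
    (h : IsScalarExtension b₀ b₀' b b' π.toLinearMap πK.toLinearMap) :
    IsScalarExtension b₀' b₀ b' b π.symm.toLinearMap πK.symm.toLinearMap := by
  classical
  have hA : LinearMap.toMatrix b b' πK.toLinearMap =
      (LinearMap.toMatrix b₀ b₀' π.toLinearMap).map (algebraMap F K) := by
    ext k i
    simpa [LinearMap.toMatrix_apply] using h i k
  have h₀ : LinearMap.toMatrix b₀ b₀' π.toLinearMap * LinearMap.toMatrix b₀' b₀ π.symm.toLinearMap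
      = 1 := by
    rw [← LinearMap.toMatrix_comp b₀' b₀ b₀', ← LinearMap.toMatrix_id b₀']
    congr 1
    ext; simp
  have h₁ : LinearMap.toMatrix b' b πK.symm.toLinearMap * LinearMap.toMatrix b b' πK.toLinearMap
      = 1 := by
    rw [← LinearMap.toMatrix_comp b b' b, ← LinearMap.toMatrix_id b]
    congr 1
    ext; simp
  have hB : LinearMap.toMatrix b' b πK.symm.toLinearMap =
      (LinearMap.toMatrix b₀' b₀ π.symm.toLinearMap).map (algebraMap F K) := by
    have h₂ := congrArg (fun M => M.map (algebraMap F K)) h₀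
    simp only [Matrix.map_mul, ← hA] at h₂
    rw [Matrix.map_one _ (map_zero _) (map_one _)] at h₂
    rw [← Matrix.mul_one (LinearMap.toMatrix b' b πK.symm.toLinearMap), ← h₂, ← Matrix.mul_assoc,
      h₁, Matrix.one_mul]
  intro k i
  simpa [LinearMap.toMatrix_apply] using congrFun (congrFun hB i) k

/-- A map induced by the scalar extension of a linear bijection is regular. -/
theorem IsScalarExtension.isRegularMap {π : W₀ ≃ₗ[F] W₀'} {πK : W ≃ₗ[K] W'}
    (h : IsScalarExtension b₀ b₀' b b' π.toLinearMap πK.toLinearMap)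
    {X : Set (ℙ K W)} {Y : Set (ℙ K W')} (f : X → Y)
    (hf : ∀ p, (f p).1 = Projectivization.map πK.toLinearMap πK.injective p.1) :
    IsRegularMap F b b' f := by
  have hev : ∀ (p : ℙ K W) k, evalAt b p (coordPoly b₀ b₀' π.toLinearMap k) =
      b'.repr (πK p.rep) k := fun p k => h.aeval_coordPoly p.rep k
  intro p
  refine ⟨1, coordPoly b₀ b₀' π.toLinearMap, coordPoly_isHomogeneous _, ?_, ?_⟩
  · by_contra! hp
    refine p.1.rep_nonzero (πK.map_eq_zero_iff.mp (b'.repr.map_eq_zero_iff.mp ?_))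
    ext k
    rw [← hev, hp k]
    rfl
  · intro q _
    obtain ⟨c, hc, hq⟩ := exists_rep_map_eq πK q.1
    refine ⟨c, hc, fun k => ?_⟩
    rw [hf, hq, hev]
    simp

/-- Linear bijections defined over `F` preserve the algebraic sets defined over `F`. -/
theorem IsScalarExtension.isAlgebraicSet_image [Fintype κ] {π : W₀ ≃ₗ[F] W₀'} {πK : W ≃ₗ[K] W'}
    (h : IsScalarExtension b₀ b₀' b b' π.toLinearMap πK.toLinearMap)
    {X : Set (ℙ K W)} (hX : IsAlgebraicSet F b X) :
    IsAlgebraicSet F b' (Projectivization.map πK.toLinearMap πK.injective '' X) := by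
  obtain ⟨T, hT, rfl⟩ := hX
  -- Equations for the image arise by substituting the coordinates of the inverse map.
  let σ := coordPoly b₀' b₀ π.symm.toLinearMap
  refine ⟨(fun P => MvPolynomial.aeval σ P) '' T, ?_, ?_⟩
  · rintro _ ⟨P, hP, rfl⟩
    obtain ⟨d, hd⟩ := hT P hP
    exact ⟨1 * d, hd.aeval σ (coordPoly_isHomogeneous _)⟩
  · ext p
    have key : ∀ P ∈ T, (evalAt b (Projectivization.map πK.symm.toLinearMap πK.symm.injective p) P
        = 0 ↔ evalAt b' p (MvPolynomial.aeval σ P) = 0) := by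
      intro P hP
      obtain ⟨d, hd⟩ := hT P hP
      -- The chosen representative of the preimage is only a multiple of the preimage of the
      -- representative; homogeneity makes the factor harmless.
      obtain ⟨c, hc, hp⟩ := exists_rep_map_eq πK.symm p
      have h₁ : evalAt b' p (MvPolynomial.aeval σ P) =
          MvPolynomial.aeval (fun i => b.repr (πK.symm p.rep) i) P := by
        rw [evalAt, MvPolynomial.comp_aeval_apply]
        exact congrArg (fun x => MvPolynomial.aeval x P)
          (funext fun i => h.symm.aeval_coordPoly p.rep i)
      rw [h₁, evalAt, hp]
      simp only [map_smul, Finsupp.smul_apply, smul_eq_mul, aeval_mul_of_isHomogeneous hd,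
        mul_eq_zero, pow_eq_zero_iff', hc, false_and, false_or]
    simp only [Set.mem_image, Set.mem_ofPred_eq, forall_exists_index, and_imp,
      forall_apply_eq_imp_iff₂]
    constructor
    · rintro ⟨q, hq, rfl⟩ P hP
      rw [← key P hP, map_symm_map]
      exact hq P hP
    · intro hp
      exact ⟨_, fun P hP => (key P hP).mpr (hp P hP), map_map_symm πK p⟩

/-- A linear bijection defined over `F` induces isomorphisms between algebraic sets. -/
theorem IsScalarExtension.isVarietyIso [Fintype κ] {π : W₀ ≃ₗ[F] W₀'} {πK : W ≃ₗ[K] W'}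
    (h : IsScalarExtension b₀ b₀' b b' π.toLinearMap πK.toLinearMap)
    {X : Set (ℙ K W)} {Y : Set (ℙ K W')} (hX : IsAlgebraicSet F b X) (f : X ≃ Y)
    (hf : ∀ p, (f p).1 = Projectivization.map πK.toLinearMap πK.injective p.1) :
    IsVarietyIso F b b' X Y f where
  source_algebraic := hX
  target_algebraic := by
    convert h.isAlgebraicSet_image hX
    ext q
    constructor
    · intro hq
      exact ⟨(f.symm ⟨q, hq⟩).1, (f.symm ⟨q, hq⟩).2, by rw [← hf, Equiv.apply_symm_apply]⟩
    · rintro ⟨p, hp, rfl⟩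
      rw [← hf ⟨p, hp⟩]
      exact (f ⟨p, hp⟩).2
  regular := h.isRegularMap f hf
  regular_symm := h.symm.isRegularMap f.symm fun q => by
    rw [← map_symm_map πK (f.symm q).1, ← hf, Equiv.apply_symm_apply]

end ScalarExtension

end LinearMorphisms

/-! ### Quadratic equations of the Veronese variety -/

section Veronese

variable {K : Type*} [Field K] {n : ℕ}

theorem veroneseMap_mk (x : Fin n → K) (i j : Fin n) : veroneseMap K n x s(i, j) = x i * x j :=
  rfl

theorem veroneseMap_ne_zero {x : Fin n → K} (hx : x ≠ 0) : veroneseMap K n x ≠ 0 := by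
  obtain ⟨i, hi⟩ := Function.ne_iff.mp hx
  exact fun h => mul_ne_zero hi hi (congrFun h s(i, i))

/-- The non-zero multiples of the vectors `veroneseMap x` are cut out by quadrics. -/
theorem exists_span_veroneseMap_iff {X : Sym2 (Fin n) → K} (hX : X ≠ 0) :
    (∃ x : Fin n → K, x ≠ 0 ∧
      Submodule.span K {X} = Submodule.span K {veroneseMap K n x}) ↔
    ∀ i j k, X s(i, j) * X s(i, k) = X s(i, i) * X s(j, k) := by
  constructor
  · rintro ⟨x, -, hx⟩ i j k
    obtain ⟨c, rfl⟩ := Submodule.mem_span_singleton.mp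
      (hx ▸ Submodule.mem_span_singleton_self X : X ∈ Submodule.span K {veroneseMap K n x})
    simp only [Pi.smul_apply, veroneseMap_mk, smul_eq_mul]
    ring
  · intro h
    -- If the diagonal vanished, `X s(j,k)² = X s(j,j) * X s(k,k)` would force `X = 0`.
    obtain ⟨i, hi⟩ : ∃ i, X s(i, i) ≠ 0 := by
      by_contra! h0
      refine hX (funext fun s => ?_)
      induction s using Sym2.ind with
      | h j k =>
        have := h j k k
        rw [h0 j, zero_mul] at this
        exact mul_self_eq_zero.mp this
    -- Row `i` of the symmetric rank-one matrix `X` is the point sought. Its Veronese image is `X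
    -- s(i,i) • X`, so no square root is needed.
    refine ⟨fun j => X s(i, j), fun h0 => hi (congrFun h0 i), ?_⟩
    have hv : veroneseMap K n (fun j => X s(i, j)) = X s(i, i) • X := by
      funext s
      induction s using Sym2.ind with
      | h j k => exact h i j k
    rw [hv, Submodule.span_singleton_smul_eq (IsUnit.mk0 _ hi)]

theorem veroneseVariety_isAlgebraicSet (F : Type*) [Field F] [Algebra F K] :
    IsAlgebraicSet F (Pi.basisFun K (Sym2 (Fin n))) (veroneseVariety K n) := by
  refine ⟨{P | ∃ i j k : Fin n, P = MvPolynomial.X s(i, j) * MvPolynomial.X s(i, k) -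
    MvPolynomial.X s(i, i) * MvPolynomial.X s(j, k)}, ?_, ?_⟩
  · rintro _ ⟨i, j, k, rfl⟩
    exact ⟨1 + 1, ((MvPolynomial.isHomogeneous_X _ _).mul (MvPolynomial.isHomogeneous_X _ _)).sub
      ((MvPolynomial.isHomogeneous_X _ _).mul (MvPolynomial.isHomogeneous_X _ _))⟩
  · ext p
    simp only [veroneseVariety, Set.mem_ofPred_eq, p.submodule_eq,
      exists_span_veroneseMap_iff p.rep_nonzero]
    constructor
    · rintro h _ ⟨i, j, k, rfl⟩
      simpa [evalAt, sub_eq_zero] using h i j k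
    · intro h i j k
      simpa [evalAt, sub_eq_zero] using h _ ⟨i, j, k, rfl⟩

end Veronese

/-! ### Plücker coordinates and the linear bijection -/

section Bivectors

variable {K V : Type*} [Field K] [AddCommGroup V] [Module K V]

variable (K V) in
/-- The exterior product of two vectors as a bilinear map. -/
noncomputable def wedge : V →ₗ[K] V →ₗ[K] ⋀[K]^2 V :=
  LinearMap.mk₂ K (fun x y => exteriorPower.ιMulti K 2 ![x, y])
    (fun x x' y => by
      have h : ∀ z, Function.update ![x, y] 0 z = ![z, y] := fun z => by
        ext i; fin_cases i <;> rfl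
      simpa only [h] using (exteriorPower.ιMulti K 2).map_update_add ![x, y] 0 x x')
    (fun c x y => by
      have h : ∀ z, Function.update ![x, y] 0 z = ![z, y] := fun z => by
        ext i; fin_cases i <;> rfl
      simpa only [h] using (exteriorPower.ιMulti K 2).map_update_smul ![x, y] 0 c x)
    (fun x y y' => by
      have h : ∀ z, Function.update ![x, y] 1 z = ![x, z] := fun z => by
        ext i; fin_cases i <;> rfl
      simpa only [h] using (exteriorPower.ιMulti K 2).map_update_add ![x, y] 1 y y')
    (fun c x y => by
      have h : ∀ z, Function.update ![x, y] 1 z = ![x, z] := fun z => by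
        ext i; fin_cases i <;> rfl
      simpa only [h] using (exteriorPower.ιMulti K 2).map_update_smul ![x, y] 1 c y)

theorem wedge_apply (x y : V) : wedge K V x y = exteriorPower.ιMulti K 2 ![x, y] := rfl

theorem wedge_self (x : V) : wedge K V x x = 0 :=
  (exteriorPower.ιMulti K 2).map_eq_zero_of_eq ![x, x] (i := 0) (j := 1) rfl (by decide)

theorem wedge_swap (x y : V) : wedge K V y x = -wedge K V x y := by
  have h := wedge_self (K := K) (x + y)
  simp only [map_add, LinearMap.add_apply, wedge_self, zero_add, add_zero] at h
  exact eq_neg_of_add_eq_zero_left (by rw [add_comm] at h; rwa [add_comm])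

theorem linearIndependent_of_wedge_ne_zero {x y : V} (h : wedge K V x y ≠ 0) :
    LinearIndependent K ![x, y] := by
  by_contra h'
  exact h ((exteriorPower.ιMulti K 2).map_linearDependent _ h')

/-- The Plücker coordinate with indices `i` and `j`. -/
noncomputable def plucker (f : Module.Basis (Fin 5) K V) (i j : Fin 5) : ⋀[K]^2 V →ₗ[K] K :=
  exteriorPower.alternatingMapLinearEquiv
    (Matrix.detRowAlternating.compLinearMap (LinearMap.pi ![f.coord i, f.coord j]))

theorem plucker_wedge (f : Module.Basis (Fin 5) K V) (i j : Fin 5) (x y : V) :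
    plucker f i j (wedge K V x y) =
      f.repr x i * f.repr y j - f.repr x j * f.repr y i := by
  rw [plucker, wedge_apply, exteriorPower.alternatingMapLinearEquiv_apply_ιMulti]
  simp only [AlternatingMap.compLinearMap_apply]
  refine (Matrix.det_fin_two _).trans ?_
  simp

/-- The linear map induced by `x ↦ u ∧ v`, where `x` is a point of `PG(3, K)` and `⟨u, v⟩` the
corresponding totally isotropic line. -/
noncomputable def bivectorMap (f : Fin 5 → V) : (Sym2 (Fin 4) → K) →ₗ[K] ⋀[K]^2 V where
  toFun X :=
    X s(0, 0) • wedge K V (f 0) (f 1) - (X s(0, 1) + X s(2, 3)) • wedge K V (f 0) (f 2)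
    + X s(2, 2) • wedge K V (f 0) (f 3) - X s(0, 2) • wedge K V (f 0) (f 4)
    - X s(3, 3) • wedge K V (f 1) (f 2) - (X s(0, 1) - X s(2, 3)) • wedge K V (f 1) (f 3)
    - X s(0, 3) • wedge K V (f 1) (f 4) + X s(1, 1) • wedge K V (f 2) (f 3)
    + X s(1, 3) • wedge K V (f 2) (f 4) - X s(1, 2) • wedge K V (f 3) (f 4)
  map_add' X Y := by simp only [Pi.add_apply]; module
  map_smul' c X := by simp only [Pi.smul_apply, smul_eq_mul, RingHom.id_apply]; module

theorem bivectorMap_apply (f : Fin 5 → V) (X : Sym2 (Fin 4) → K) : bivectorMap f X =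
    X s(0, 0) • wedge K V (f 0) (f 1) - (X s(0, 1) + X s(2, 3)) • wedge K V (f 0) (f 2)
    + X s(2, 2) • wedge K V (f 0) (f 3) - X s(0, 2) • wedge K V (f 0) (f 4)
    - X s(3, 3) • wedge K V (f 1) (f 2) - (X s(0, 1) - X s(2, 3)) • wedge K V (f 1) (f 3)
    - X s(0, 3) • wedge K V (f 1) (f 4) + X s(1, 1) • wedge K V (f 2) (f 3)
    + X s(1, 3) • wedge K V (f 2) (f 4) - X s(1, 2) • wedge K V (f 3) (f 4) := rfl

/-- The coordinates of a vector of `Sym2 (Fin 4) → K` in terms of the Plücker coordinates of its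
image. -/
theorem plucker_bivectorMap (f : Module.Basis (Fin 5) K V) (X : Sym2 (Fin 4) → K) :
    plucker f 0 1 (bivectorMap f X) = X s(0, 0) ∧
    plucker f 0 2 (bivectorMap f X) = -(X s(0, 1) + X s(2, 3)) ∧
    plucker f 0 3 (bivectorMap f X) = X s(2, 2) ∧
    plucker f 0 4 (bivectorMap f X) = -X s(0, 2) ∧
    plucker f 1 2 (bivectorMap f X) = -X s(3, 3) ∧
    plucker f 1 3 (bivectorMap f X) = -(X s(0, 1) - X s(2, 3)) ∧
    plucker f 1 4 (bivectorMap f X) = -X s(0, 3) ∧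
    plucker f 2 3 (bivectorMap f X) = X s(1, 1) ∧
    plucker f 2 4 (bivectorMap f X) = X s(1, 3) ∧
    plucker f 3 4 (bivectorMap f X) = -X s(1, 2) := by
  simp [bivectorMap_apply, plucker_wedge]

theorem bivectorMap_injective (h2 : (2 : K) ≠ 0) (f : Module.Basis (Fin 5) K V) :
    Function.Injective (bivectorMap (K := K) f) := by
  rw [injective_iff_map_eq_zero]
  intro X hX
  obtain ⟨h01, h02, h03, h04, h12, h13, h14, h23, h24, h34⟩ := plucker_bivectorMap f X
  rw [hX, map_zero] at h01 h02 h03 h04 h12 h13 h14 h23 h24 h34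
  simp only [eq_comm (a := (0 : K)), neg_eq_zero] at h01 h02 h03 h04 h12 h13 h14 h23 h24 h34
  -- Only the sum and the difference of `X s(0,1)` and `X s(2,3)` occur; here 2 must be invertible.
  have ha : X s(0, 1) = 0 :=
    (mul_eq_zero.mp (by linear_combination h02 + h13 : 2 * X s(0, 1) = 0)).resolve_left h2
  have hb : X s(2, 3) = 0 :=
    (mul_eq_zero.mp (by linear_combination h02 - h13 : 2 * X s(2, 3) = 0)).resolve_left h2
  have hs : ∀ i j, X s(i, j) = X s(j, i) := fun i j => by rw [Sym2.eq_swap]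
  funext s
  induction s using Sym2.ind with
  | h i j =>
    fin_cases i <;> fin_cases j <;>
      simp only [Fin.mk_one, Fin.zero_eta, Fin.reduceFinMk, Pi.zero_apply] <;>
      first
      | assumption
      | (rw [hs]; assumption)

/-- `bivectorMap` as a linear bijection. -/
noncomputable def bivectorEquiv (h2 : (2 : K) ≠ 0) (f : Module.Basis (Fin 5) K V) :
    (Sym2 (Fin 4) → K) ≃ₗ[K] ⋀[K]^2 V :=
  haveI : Module.Finite K V := .of_basis f
  (bivectorMap f).linearEquivOfInjective (bivectorMap_injective h2 f) (by
    rw [exteriorPower.finrank_eq, Module.finrank_eq_card_basis f, Module.finrank_fintype_fun_eq_card]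
    rfl)

theorem bivectorEquiv_apply (h2 : (2 : K) ≠ 0) (f : Module.Basis (Fin 5) K V)
    (X : Sym2 (Fin 4) → K) : bivectorEquiv h2 f X = bivectorMap f X := rfl

end Bivectors

/-! ### Points of the Veronese variety and totally isotropic lines -/

section IsotropicLines

variable {K V : Type*} [Field K] [AddCommGroup V] [Module K V]

/-- The Gram matrix of the bilinearization of `x₀ x₂ + x₁ x₃ - x₄ ^ 2`. -/
def splitGram : Matrix (Fin 5) (Fin 5) ℤ :=
  !![0, 0, 1, 0, 0; 0, 0, 0, 1, 0; 1, 0, 0, 0, 0; 0, 1, 0, 0, 0; 0, 0, 0, 0, -2]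

/-- With respect to the basis `f`, the form `φ` is a non-zero multiple of the bilinearization of
`x₀ x₂ + x₁ x₃ - x₄ ^ 2`. -/
def IsSplitBasis (φ : LinearMap.BilinForm K V) (f : Module.Basis (Fin 5) K V) : Prop :=
  ∃ c : K, c ≠ 0 ∧ ∀ i j, φ (f i) (f j) = c * (splitGram i j : K)

theorem IsSplitBasis.apply_eq_zero_iff {φ : LinearMap.BilinForm K V}
    {f : Module.Basis (Fin 5) K V} (h : IsSplitBasis φ f) (x y : V) :
    φ x y = 0 ↔ f.repr x 0 * f.repr y 2 + f.repr x 2 * f.repr y 0 + f.repr x 1 * f.repr y 3 +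
      f.repr x 3 * f.repr y 1 = 2 * (f.repr x 4 * f.repr y 4) := by
  obtain ⟨c, hc, h⟩ := h
  have key : φ x y = c * (f.repr x 0 * f.repr y 2 + f.repr x 2 * f.repr y 0 +
      f.repr x 1 * f.repr y 3 + f.repr x 3 * f.repr y 1 - 2 * (f.repr x 4 * f.repr y 4)) := by
    conv_lhs => rw [← f.sum_repr x, ← f.sum_repr y]
    simp only [Fin.sum_univ_five, map_add, map_smul, LinearMap.add_apply, LinearMap.smul_apply, h,
      splitGram]
    simp
    ring
  rw [key, mul_eq_zero, or_iff_right hc, sub_eq_zero]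

theorem wedge_eq_sum (f : Module.Basis (Fin 5) K V) (x y : V) : wedge K V x y =
    (f.repr x 0 * f.repr y 1 - f.repr x 1 * f.repr y 0) • wedge K V (f 0) (f 1)
    + (f.repr x 0 * f.repr y 2 - f.repr x 2 * f.repr y 0) • wedge K V (f 0) (f 2)
    + (f.repr x 0 * f.repr y 3 - f.repr x 3 * f.repr y 0) • wedge K V (f 0) (f 3)
    + (f.repr x 0 * f.repr y 4 - f.repr x 4 * f.repr y 0) • wedge K V (f 0) (f 4)
    + (f.repr x 1 * f.repr y 2 - f.repr x 2 * f.repr y 1) • wedge K V (f 1) (f 2)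
    + (f.repr x 1 * f.repr y 3 - f.repr x 3 * f.repr y 1) • wedge K V (f 1) (f 3)
    + (f.repr x 1 * f.repr y 4 - f.repr x 4 * f.repr y 1) • wedge K V (f 1) (f 4)
    + (f.repr x 2 * f.repr y 3 - f.repr x 3 * f.repr y 2) • wedge K V (f 2) (f 3)
    + (f.repr x 2 * f.repr y 4 - f.repr x 4 * f.repr y 2) • wedge K V (f 2) (f 4)
    + (f.repr x 3 * f.repr y 4 - f.repr x 4 * f.repr y 3) • wedge K V (f 3) (f 4) := by
  conv_lhs => rw [← f.sum_repr x, ← f.sum_repr y]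
  simp only [Fin.sum_univ_five, map_add, map_smul, LinearMap.add_apply, LinearMap.smul_apply,
    wedge_self, wedge_swap (f 0) (f 1), wedge_swap (f 0) (f 2), wedge_swap (f 0) (f 3),
    wedge_swap (f 0) (f 4), wedge_swap (f 1) (f 2), wedge_swap (f 1) (f 3),
    wedge_swap (f 1) (f 4), wedge_swap (f 2) (f 3), wedge_swap (f 2) (f 4),
    wedge_swap (f 3) (f 4)]
  module

/-- The matrix of Plücker coordinates of the line corresponding to the point `x` of `PG(3, K)`. -/
def lineMatrix (x : Fin 4 → K) : Matrix (Fin 5) (Fin 5) K :=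
  !![0, x 0 * x 0, -(x 0 * x 1 + x 2 * x 3), x 2 * x 2, -(x 0 * x 2);
    -(x 0 * x 0), 0, -(x 3 * x 3), -(x 0 * x 1 - x 2 * x 3), -(x 0 * x 3);
    x 0 * x 1 + x 2 * x 3, x 3 * x 3, 0, x 1 * x 1, x 1 * x 3;
    -(x 2 * x 2), x 0 * x 1 - x 2 * x 3, -(x 1 * x 1), 0, -(x 1 * x 2);
    x 0 * x 2, x 0 * x 3, -(x 1 * x 3), x 1 * x 2, 0]

/-- The points of the line corresponding to `x` given by the rows of `lineMatrix x`. -/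
noncomputable def lineVector (f : Module.Basis (Fin 5) K V) (x : Fin 4 → K) (a : Fin 5) : V :=
  f.equivFun.symm (lineMatrix x a)

theorem repr_lineVector (f : Module.Basis (Fin 5) K V) (x : Fin 4 → K) (a i : Fin 5) :
    f.repr (lineVector f x a) i = lineMatrix x a i := by
  rw [← Module.Basis.equivFun_apply, lineVector, LinearEquiv.apply_symm_apply]

theorem IsSplitBasis.apply_lineVector {φ : LinearMap.BilinForm K V}
    {f : Module.Basis (Fin 5) K V} (h : IsSplitBasis φ f) (x : Fin 4 → K) (a b : Fin 5) :
    φ (lineVector f x a) (lineVector f x b) = 0 := by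
  rw [h.apply_eq_zero_iff]
  simp only [repr_lineVector]
  fin_cases a <;> fin_cases b <;> simp [lineMatrix] <;> ring

/-- For a line `⟨u, v⟩` with Plücker matrix `p`, row `a` is `u_a v - v_a u`, hence a vector of the
line, and rows `a` and `b` have wedge `p_ab (u ∧ v)`. It remains to find an entry that does not
vanish. -/
theorem exists_wedge_lineVector_eq_smul (f : Module.Basis (Fin 5) K V) {x : Fin 4 → K}
    (hx : x ≠ 0) : ∃ a b, ∃ c : K, c ≠ 0 ∧
      wedge K V (lineVector f x a) (lineVector f x b) =
        c • bivectorMap f (veroneseMap K 4 x) := by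
  obtain ⟨i, hi⟩ := Function.ne_iff.mp hx
  have hw := fun a b => wedge_eq_sum f (lineVector f x a) (lineVector f x b)
  simp only [repr_lineVector] at hw
  have hc : x i * x i ≠ 0 := mul_ne_zero hi hi
  simp only [bivectorMap_apply, veroneseMap_mk]
  -- The squares of the four coordinates occur as the entries (0,1), (2,3), (0,3) and (2,1) of the
  -- matrix.
  fin_cases i
  · refine ⟨0, 1, _, hc, (hw 0 1).trans ?_⟩
    simp [lineMatrix]
    match_scalars <;> ring
  · refine ⟨2, 3, _, hc, (hw 2 3).trans ?_⟩
    simp [lineMatrix]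
    match_scalars <;> ring
  · refine ⟨0, 3, _, hc, (hw 0 3).trans ?_⟩
    simp [lineMatrix]
    match_scalars <;> ring
  · refine ⟨2, 1, _, hc, (hw 2 1).trans ?_⟩
    simp [lineMatrix]
    match_scalars <;> ring

/-- The vectors of `Sym2 (Fin 4) → K` corresponding to totally isotropic lines satisfy the equations
of the Veronese variety. -/
theorem IsSplitBasis.mul_eq_mul_of_bivectorMap_eq_wedge (h2 : (2 : K) ≠ 0)
    {φ : LinearMap.BilinForm K V} {f : Module.Basis (Fin 5) K V} (h : IsSplitBasis φ f)
    {X : Sym2 (Fin 4) → K} {x y : V} (hX : bivectorMap f X = wedge K V x y)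
    (hxx : φ x x = 0) (hxy : φ x y = 0) (hyy : φ y y = 0) (i j k : Fin 4) :
    X s(i, j) * X s(i, k) = X s(i, i) * X s(j, k) := by
  obtain ⟨h01, h02, h03, h04, h12, h13, h14, h23, h24, h34⟩ := plucker_bivectorMap f X
  simp only [hX, plucker_wedge] at h01 h02 h03 h04 h12 h13 h14 h23 h24 h34
  rw [h.apply_eq_zero_iff] at hxx hxy hyy
  generalize f.repr x = u at *
  generalize f.repr y = v at *
  have hu : u 0 * u 2 + u 1 * u 3 = u 4 ^ 2 := mul_left_cancel₀ h2 (by linear_combination hxx)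
  have hv : v 0 * v 2 + v 1 * v 3 = v 4 ^ 2 := mul_left_cancel₀ h2 (by linear_combination hyy)
  have e00 : 2 * X s(0, 0) = 2 * (u 0 * v 1 - u 1 * v 0) := by linear_combination -2 * h01
  have e11 : 2 * X s(1, 1) = 2 * (u 2 * v 3 - u 3 * v 2) := by linear_combination -2 * h23
  have e22 : 2 * X s(2, 2) = 2 * (u 0 * v 3 - u 3 * v 0) := by linear_combination -2 * h03
  have e33 : 2 * X s(3, 3) = -2 * (u 1 * v 2 - u 2 * v 1) := by linear_combination 2 * h12
  have e02 : 2 * X s(0, 2) = -2 * (u 0 * v 4 - u 4 * v 0) := by linear_combination 2 * h04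
  have e03 : 2 * X s(0, 3) = -2 * (u 1 * v 4 - u 4 * v 1) := by linear_combination 2 * h14
  have e13 : 2 * X s(1, 3) = 2 * (u 2 * v 4 - u 4 * v 2) := by linear_combination -2 * h24
  have e12 : 2 * X s(1, 2) = -2 * (u 3 * v 4 - u 4 * v 3) := by linear_combination 2 * h34
  have e01 : 2 * X s(0, 1) = -((u 0 * v 2 - u 2 * v 0) + (u 1 * v 3 - u 3 * v 1)) := by
    linear_combination h02 + h13
  have e23 : 2 * X s(2, 3) = (u 1 * v 3 - u 3 * v 1) - (u 0 * v 2 - u 2 * v 0) := by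
    linear_combination h02 - h13
  have hs : ∀ i j, X s(i, j) = X s(j, i) := fun i j => by rw [Sym2.eq_swap]
  have s10 := hs 1 0
  have s20 := hs 2 0
  have s30 := hs 3 0
  have s21 := hs 2 1
  have s31 := hs 3 1
  have s32 := hs 3 2
  -- With a factor 2 for each coordinate, every product becomes an integral polynomial in the
  -- Plücker coordinates, although `X s(0,1)` and `X s(2,3)` involve halves. The equations then hold
  -- modulo the three isotropy relations.
  refine mul_left_cancel₀ (mul_ne_zero h2 h2) ?_
  rw [mul_mul_mul_comm, mul_mul_mul_comm 2 2]
  clear hX h01 h02 h03 h04 h12 h13 h14 h23 h24 h34 hs hxx hyy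
  fin_cases i <;> fin_cases j <;> fin_cases k <;>
    simp only [Fin.mk_one, Fin.zero_eta, Fin.reduceFinMk, Fin.isValue] <;>
    simp only [s10, s20, s30, s21, s31, s32, e00, e11, e22, e33, e02, e03, e13, e12, e01, e23] <;>
    clear * - hu hv hxy <;>
    first
    | done
    | ring1
    | grind

/-- The linear bijection `bivectorEquiv` maps the Veronese variety onto the set of totally isotropic
lines. -/
theorem IsSplitBasis.image_veroneseVariety (h2 : (2 : K) ≠ 0)
    {φ : LinearMap.BilinForm K V} {f : Module.Basis (Fin 5) K V} (h : IsSplitBasis φ f) :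
    Projectivization.map (bivectorEquiv h2 f).toLinearMap (bivectorEquiv h2 f).injective ''
      veroneseVariety K 4 = phiSubset φ := by
  ext p
  constructor
  · rintro ⟨q, ⟨x, hx, hq⟩, rfl⟩
    obtain ⟨a, b, d, hd, hw⟩ := exists_wedge_lineVector_eq_smul f hx
    have hne : wedge K V (lineVector f x a) (lineVector f x b) ≠ 0 := by
      rw [hw, ← bivectorEquiv_apply h2]
      exact smul_ne_zero hd ((bivectorEquiv h2 f).map_ne_zero_iff.mpr (veroneseMap_ne_zero hx))
    have hli := linearIndependent_of_wedge_ne_zero hne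
    refine ⟨Submodule.span K {lineVector f x a, lineVector f x b}, ⟨?_, ?_⟩, _, _, rfl, ?_⟩
    · have := finrank_span_eq_card hli
      rwa [Matrix.range_cons_cons_empty] at this
    · intro u hu v hv
      obtain ⟨c, d, rfl⟩ := Submodule.mem_span_pair.mp hu
      obtain ⟨c', d', rfl⟩ := Submodule.mem_span_pair.mp hv
      simp [h.apply_lineVector]
    · rw [← wedge_apply, hw, Submodule.span_singleton_smul_eq (IsUnit.mk0 _ hd)]
      obtain ⟨c, hc, hr⟩ := exists_rep_map_eq (bivectorEquiv h2 f) q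
      rw [Projectivization.submodule_eq, hr, Submodule.span_singleton_smul_eq (IsUnit.mk0 _ hc)]
      rw [Projectivization.submodule_eq] at hq
      have := congrArg (Submodule.map (bivectorEquiv h2 f).toLinearMap) hq
      rwa [Submodule.map_span, Submodule.map_span, Set.image_singleton, Set.image_singleton] at this
  · rintro ⟨S, ⟨-, hS⟩, x, y, rfl, hp⟩
    have hx : x ∈ Submodule.span K {x, y} := Submodule.subset_span (by simp)
    have hy : y ∈ Submodule.span K {x, y} := Submodule.subset_span (by simp)
    set X := (bivectorEquiv h2 f).symm (wedge K V x y) with hXdef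
    have hX : bivectorEquiv h2 f X = wedge K V x y := LinearEquiv.apply_symm_apply _ _
    have hne : wedge K V x y ≠ 0 := by
      intro h0
      rw [wedge_apply] at h0
      rw [h0, Submodule.span_zero_singleton, Projectivization.submodule_eq,
        Submodule.span_singleton_eq_bot] at hp
      exact p.rep_nonzero hp
    have hX0 : X ≠ 0 := by
      rintro h0
      rw [h0, map_zero] at hX
      exact hne hX.symm
    refine ⟨Projectivization.mk K X hX0, ?_, ?_⟩
    · simp only [veroneseVariety, Set.mem_ofPred_eq, Projectivization.submodule_mk]
      rw [exists_span_veroneseMap_iff hX0]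
      exact h.mul_eq_mul_of_bivectorMap_eq_wedge h2 hX (hS x hx x hx) (hS x hx y hy)
        (hS y hy y hy)
    · refine Projectivization.submodule_injective ?_
      rw [Projectivization.map_mk, Projectivization.submodule_mk, hp]
      exact congrArg (fun w => Submodule.span K {w}) hX

end IsotropicLines

/-! ### Normal form of the quadratic form -/

section NormalForm

variable {F V : Type*} [Field F] [AddCommGroup V] [Module F V]

/-- A linearly independent pair spanning a totally isotropic plane of a non-degenerate symmetric
bilinear form is half of a pair of hyperbolic pairs. -/
theorem exists_hyperbolic_pairs [FiniteDimensional F V] (h2 : (2 : F) ≠ 0)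
    {B : LinearMap.BilinForm F V} (hB : ∀ x y, B x y = B y x)
    (hnd : ∀ x, (∀ y, B x y = 0) → x = 0) {S : Submodule F V} (hS : Module.finrank F S = 2)
    (hS0 : ∀ x ∈ S, ∀ y ∈ S, B x y = 0) :
    ∃ x₀ x₁ y₀ y₁ : V, B x₀ x₀ = 0 ∧ B x₁ x₁ = 0 ∧ B x₀ x₁ = 0 ∧ B y₀ y₀ = 0 ∧ B y₁ y₁ = 0 ∧
      B y₀ y₁ = 0 ∧ B x₀ y₀ = 1 ∧ B x₁ y₁ = 1 ∧ B x₀ y₁ = 0 ∧ B x₁ y₀ = 0 := by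
  have hsurj : Function.Surjective B := by
    refine (LinearMap.injective_iff_surjective_of_finrank_eq_finrank
      (Subspace.dual_finrank_eq (K := F) (V := V)).symm).mp ?_
    rw [injective_iff_map_eq_zero]
    exact fun x hx => hnd x fun y => by rw [hx]; rfl
  let s : Module.Basis (Fin 2) F S := Module.finBasisOfFinrankEq F S hS
  have hdual : ∀ i, ∃ g : V, ∀ j, B (s j) g = if j = i then 1 else 0 := by
    intro i
    -- By non-degeneracy, the dual basis of `S`, extended to `V`, is represented by vectors.
    obtain ⟨l, hl⟩ := (s.coord i).exists_extend
    obtain ⟨g, rfl⟩ := hsurj l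
    refine ⟨g, fun j => ?_⟩
    have := LinearMap.congr_fun hl (s j)
    simpa [Finsupp.single_apply, hB g] using this
  obtain ⟨g₀, hg₀⟩ := hdual 0
  obtain ⟨g₁, hg₁⟩ := hdual 1
  have a00 : B (s 0) (s 0) = 0 := hS0 _ (s 0).2 _ (s 0).2
  have a01 : B (s 0) (s 1) = 0 := hS0 _ (s 0).2 _ (s 1).2
  have a10 : B (s 1) (s 0) = 0 := hS0 _ (s 1).2 _ (s 0).2
  have a11 : B (s 1) (s 1) = 0 := hS0 _ (s 1).2 _ (s 1).2
  have b00 : B (s 0) g₀ = 1 := by simpa using hg₀ 0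
  have b10 : B (s 1) g₀ = 0 := by simpa using hg₀ 1
  have b01 : B (s 0) g₁ = 0 := by simpa using hg₁ 0
  have b11 : B (s 1) g₁ = 1 := by simpa using hg₁ 1
  have c00 : B g₀ (s 0) = 1 := by rw [hB, b00]
  have c01 : B g₀ (s 1) = 0 := by rw [hB, b10]
  have c11 : B g₁ (s 1) = 1 := by rw [hB, b11]
  -- Adding vectors of `S` keeps the pairings with `S`. The halved terms remove `B g₀ g₀` and `B g₁
  -- g₁`, and the multiple of `s 1` removes `B g₀ g₁`.
  refine ⟨s 0, s 1, g₀ - (B g₀ g₀ / 2) • (s 0 : V) - (B g₀ g₁) • (s 1 : V),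
    g₁ - (B g₁ g₁ / 2) • (s 1 : V), a00, a11, a01, ?_, ?_, ?_, ?_, ?_, ?_, ?_⟩
  all_goals
    simp only [map_sub, map_smul, LinearMap.sub_apply, LinearMap.smul_apply, smul_eq_mul,
      a00, a01, a10, a11, b00, b10, b01, b11, c00, c01, c11]
    try field_simp
    try ring

theorem exists_isSplitBasis_of_symm (h2 : (2 : F) ≠ 0) (hV : Module.finrank F V = 5)
    {B : LinearMap.BilinForm F V} (hB : ∀ x y, B x y = B y x)
    (hnd : ∀ x, (∀ y, B x y = 0) → x = 0) {S : Submodule F V} (hS : Module.finrank F S = 2)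
    (hS0 : ∀ x ∈ S, ∀ y ∈ S, B x y = 0) :
    ∃ f : Module.Basis (Fin 5) F V, IsSplitBasis B f := by
  have : FiniteDimensional F V := .of_finrank_pos (by omega)
  obtain ⟨x₀, x₁, y₀, y₁, hx₀, hx₁, hx, hy₀, hy₁, hy, h00, h11, h01, h10⟩ :=
    exists_hyperbolic_pairs h2 hB hnd hS hS0
  -- Four linear conditions in dimension five leave a non-zero vector orthogonal to both hyperbolic
  -- pairs.
  obtain ⟨z, hz, hz0⟩ := (Submodule.ne_bot_iff _).mp (LinearMap.ker_ne_bot_of_finrank_lt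
    (f := LinearMap.pi ![B x₀, B x₁, B y₀, B y₁]) (by simp [hV]))
  have hz' := fun i => congrFun (LinearMap.mem_ker.mp hz) i
  have zx₀ : B x₀ z = 0 := hz' 0
  have zx₁ : B x₁ z = 0 := hz' 1
  have zy₀ : B y₀ z = 0 := hz' 2
  have zy₁ : B y₁ z = 0 := hz' 3
  have hx' := (hB x₁ x₀).trans hx
  have hy' := (hB y₁ y₀).trans hy
  have h00' := (hB y₀ x₀).trans h00
  have h11' := (hB y₁ x₁).trans h11
  have h01' := (hB y₁ x₀).trans h01
  have h10' := (hB y₀ x₁).trans h10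
  have zx₀' := (hB z x₀).trans zx₀
  have zx₁' := (hB z x₁).trans zx₁
  have zy₀' := (hB z y₀).trans zy₀
  have zy₁' := (hB z y₁).trans zy₁
  have hli : LinearIndependent F ![x₀, x₁, y₀, y₁, z] := by
    rw [Fintype.linearIndependent_iff]
    intro g hg
    simp only [Fin.sum_univ_five] at hg
    change g 0 • x₀ + g 1 • x₁ + g 2 • y₀ + g 3 • y₁ + g 4 • z = 0 at hg
    have g0 : g 0 = 0 := by
      simpa [hx₀, hx₁, hy₀, hy₁, hx, hy, h00, h11, h01, h10, hx', hy', h00', h11', h01', h10',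
        zx₀, zx₁, zy₀, zy₁] using congrArg (B y₀) hg
    have g1 : g 1 = 0 := by
      simpa [hx₀, hx₁, hy₀, hy₁, hx, hy, h00, h11, h01, h10, hx', hy', h00', h11', h01', h10',
        zx₀, zx₁, zy₀, zy₁] using congrArg (B y₁) hg
    have g2 : g 2 = 0 := by
      simpa [hx₀, hx₁, hy₀, hy₁, hx, hy, h00, h11, h01, h10, hx', hy', h00', h11', h01', h10',
        zx₀, zx₁, zy₀, zy₁] using congrArg (B x₀) hg
    have g3 : g 3 = 0 := by
      simpa [hx₀, hx₁, hy₀, hy₁, hx, hy, h00, h11, h01, h10, hx', hy', h00', h11', h01', h10',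
        zx₀, zx₁, zy₀, zy₁] using congrArg (B x₁) hg
    have g4 : g 4 = 0 := by simpa [g0, g1, g2, g3, hz0] using hg
    intro i
    fin_cases i <;> assumption
  obtain ⟨f, hf⟩ : ∃ f : Module.Basis (Fin 5) F V, ∀ i, f i = ![x₀, x₁, y₀, y₁, z] i :=
    ⟨basisOfLinearIndependentOfCardEqFinrank hli (by simp [hV]), fun i => by
      rw [coe_basisOfLinearIndependentOfCardEqFinrank]⟩
  -- Otherwise `z` would be orthogonal to a whole basis.
  have hzz : B z z ≠ 0 := by
    intro h0
    refine hz0 (hnd z fun y => ?_)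
    rw [← f.sum_repr y]
    simp [Fin.sum_univ_five, hf, zx₀', zx₁', zy₀', zy₁', h0]
  have hc : -(B z z / 2) ≠ 0 := neg_ne_zero.mpr (div_ne_zero hzz h2)
  -- With `c = -(B z z / 2)`, scaling `y₀` and `y₁` by `c` makes the hyperbolic entries `c`, while
  -- `B z z = -2c`. As the form matters only up to a scalar, `B z z` need not be normalised by a
  -- square root.
  have hw : ∀ i, IsUnit (![1, 1, -(B z z / 2), -(B z z / 2), 1] i : F) := by
    intro i
    fin_cases i <;> simp [hzz, h2]
  refine ⟨f.isUnitSMul hw, -(B z z / 2), hc, fun i j => ?_⟩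
  simp only [Module.Basis.isUnitSMul_apply, hf, map_smul, LinearMap.smul_apply, smul_eq_mul]
  have e : B z z = B z z / 2 * 2 := (div_mul_cancel₀ _ h2).symm
  fin_cases i <;> fin_cases j <;> 
    simp [splitGram, ← e, hx₀, hx₁, hy₀, hy₁, hx, hy, h00, h11, h01, h10, hx', hy', h00', h11', h01',
      h10', zx₀, zx₁, zy₀, zy₁, zx₀', zx₁', zy₀', zy₁']

/-- A non-singular quadratic form in five variables with a totally singular plane is, up to a
scalar, `x₀ x₂ + x₁ x₃ - x₄ ^ 2`. -/
theorem exists_isSplitBasis (h2 : (2 : F) ≠ 0) (hV : Module.finrank F V = 5)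
    {χ : QuadraticForm F V} (hχ : IsNonsingular χ) {S : Submodule F V}
    (hS : Module.finrank F S = 2) (hS0 : ∀ x ∈ S, χ x = 0) :
    ∃ f : Module.Basis (Fin 5) F V, IsSplitBasis (QuadraticMap.polarBilin χ) f := by
  refine exists_isSplitBasis_of_symm h2 hV (fun x y => ?_) (fun x hx => ?_) hS
    (fun x hx y hy => ?_)
  · exact QuadraticMap.polar_comm χ x y
  · by_contra hx0
    refine hχ x hx0 hx ?_
    have h := hx x
    rw [QuadraticMap.polarBilin_apply_apply, QuadraticMap.polar_self, nsmul_eq_mul,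
      Nat.cast_ofNat] at h
    exact (mul_eq_zero.mp h).resolve_left h2
  · rw [QuadraticMap.polarBilin_apply_apply, QuadraticMap.polar, hS0 _ (S.add_mem hx hy), hS0 x hx,
      hS0 y hy]
    simp

end NormalForm

/-! ### Extension to a larger field -/

section BaseChange

variable {F V : Type*} [Field F] [AddCommGroup V] [Module F V]
variable (K : Type*) [Field K] [Algebra F K]

theorem IsSplitBasis.baseChange {φ : LinearMap.BilinForm F V} {f : Module.Basis (Fin 5) F V}
    (h : IsSplitBasis φ f) : IsSplitBasis (φ.baseChange K) (f.baseChange K) := by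
  obtain ⟨c, hc, h⟩ := h
  refine ⟨algebraMap F K c, (map_ne_zero _).mpr hc, fun i j => ?_⟩
  rw [Module.Basis.baseChange_apply, Module.Basis.baseChange_apply,
    LinearMap.BilinForm.baseChange_tmul, h, Algebra.smul_def]
  simp

theorem repr_baseChange_wedge {I : Type*} [LinearOrder I] (E : Module.Basis I F V) (x y : V)
    (s : Set.powersetCard I 2) :
    ((E.baseChange K).exteriorPower 2).repr (wedge K (K ⊗[F] V) (1 ⊗ₜ x) (1 ⊗ₜ y)) s =
      algebraMap F K ((E.exteriorPower 2).repr (wedge F V x y) s) := by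
  rw [wedge_apply, wedge_apply, exteriorPower.basis_repr_apply, exteriorPower.basis_repr_apply,
    exteriorPower.ιMultiDual_apply_ιMulti, exteriorPower.ιMultiDual_apply_ιMulti,
    Matrix.det_fin_two, Matrix.det_fin_two]
  simp [Algebra.smul_def]

/-- The basis `f` adapted to the form may differ from the coordinate basis `E`; both are bases over
`F`, so the `E`-coordinates of the wedges of vectors of `f` lie in `F` and do not change under
extension. -/
theorem bivectorMap_isScalarExtension (E f : Module.Basis (Fin 5) F V) :
    IsScalarExtension (Pi.basisFun F (Sym2 (Fin 4))) (E.exteriorPower 2)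
      (Pi.basisFun K (Sym2 (Fin 4))) ((E.baseChange K).exteriorPower 2)
      (bivectorMap f) (bivectorMap (f.baseChange K)) := by
  intro i k
  have hi : ∀ s, Pi.basisFun K (Sym2 (Fin 4)) i s =
      algebraMap F K (Pi.basisFun F (Sym2 (Fin 4)) i s) := by
    intro s
    by_cases h : s = i <;> simp [h]
  simp only [bivectorMap_apply, map_add, map_sub, map_smul, Finsupp.add_apply, Finsupp.sub_apply,
    Finsupp.smul_apply, smul_eq_mul, hi, Module.Basis.baseChange_apply, repr_baseChange_wedge,
    map_mul]

end BaseChange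

theorem phiSubset_subset_lineGrassmannian {K V : Type*} [Field K] [AddCommGroup V] [Module K V]
    (φ : LinearMap.BilinForm K V) : phiSubset φ ⊆ lineGrassmannian K V := by
  rintro p ⟨S, hS, h⟩
  exact ⟨S, hS.1, h⟩

end VeroneseGrassmann

/-! ### The isomorphism over the field and over its algebraic closure -/

theorem corollary4p2 {F V : Type*} [Field F] [AddCommGroup V] [Module F V]
    (hchar : ringChar F ≠ 2)
    (E : Module.Basis (Fin 5) F V)
    (χ : QuadraticForm F V)
    (hχ : VeroneseGrassmann.IsNonsingular χ)
    (hwitt : VeroneseGrassmann.HasWittIndex χ 2)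
    (φ : LinearMap.BilinForm F V) (hφ : φ = QuadraticMap.polarBilin χ) :
    ∃ (π : (Sym2 (Fin 4) → F) ≃ₗ[F] ⋀[F]^2 V)
      (πK : (Sym2 (Fin 4) → AlgebraicClosure F) ≃ₗ[AlgebraicClosure F]
        ⋀[AlgebraicClosure F]^2 (AlgebraicClosure F ⊗[F] V))
      (f : VeroneseGrassmann.veroneseVariety (AlgebraicClosure F) 4 ≃
        VeroneseGrassmann.phiSubset (φ.baseChange (AlgebraicClosure F))),
      -- over `F`, the linear isomorphism maps the Veronese variety onto the subset of `φ`
      Projectivization.map π.toLinearMap π.injective '' VeroneseGrassmann.veroneseVariety F 4 =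
        VeroneseGrassmann.phiSubset φ ∧
      -- its extension to the algebraic closure induces `f`
      VeroneseGrassmann.IsScalarExtension
        (Pi.basisFun F (Sym2 (Fin 4))) (E.exteriorPower 2)
        (Pi.basisFun (AlgebraicClosure F) (Sym2 (Fin 4)))
        ((E.baseChange (AlgebraicClosure F)).exteriorPower 2)
        π.toLinearMap πK.toLinearMap ∧
      (∀ p, (f p).1 = Projectivization.map πK.toLinearMap πK.injective p.1) ∧
      -- and `f` is an isomorphism of algebraic varieties, defined over `F`
      VeroneseGrassmann.phiSubset (φ.baseChange (AlgebraicClosure F)) ⊆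
        VeroneseGrassmann.lineGrassmannian (AlgebraicClosure F) (AlgebraicClosure F ⊗[F] V) ∧
      VeroneseGrassmann.IsVarietyIso F
        (Pi.basisFun (AlgebraicClosure F) (Sym2 (Fin 4)))
        ((E.baseChange (AlgebraicClosure F)).exteriorPower 2)
        (VeroneseGrassmann.veroneseVariety (AlgebraicClosure F) 4)
        (VeroneseGrassmann.phiSubset (φ.baseChange (AlgebraicClosure F))) f := by
  have h2 : (2 : F) ≠ 0 := Ring.two_ne_zero hchar
  have h2K : (2 : AlgebraicClosure F) ≠ 0 := by
    rw [← map_ofNat (algebraMap F (AlgebraicClosure F)) 2]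
    exact (map_ne_zero _).mpr h2
  have hV : Module.finrank F V = 5 := by simp [Module.finrank_eq_card_basis E]
  -- The maximum defining the Witt index is attained: `S` is a totally singular line of `PG(V)`.
  obtain ⟨S, hS0, hS⟩ := hwitt.1
  obtain ⟨f, hf⟩ := VeroneseGrassmann.exists_isSplitBasis h2 hV hχ hS hS0
  rw [← hφ] at hf
  have hfK := hf.baseChange (AlgebraicClosure F)
  let πK := VeroneseGrassmann.bivectorEquiv h2K (f.baseChange (AlgebraicClosure F))
  have hext : VeroneseGrassmann.IsScalarExtension
      (Pi.basisFun F (Sym2 (Fin 4))) (E.exteriorPower 2)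
      (Pi.basisFun (AlgebraicClosure F) (Sym2 (Fin 4)))
      ((E.baseChange (AlgebraicClosure F)).exteriorPower 2)
      (VeroneseGrassmann.bivectorEquiv h2 f).toLinearMap πK.toLinearMap :=
    VeroneseGrassmann.bivectorMap_isScalarExtension (AlgebraicClosure F) E f
  let e := (Equiv.Set.image (Projectivization.map πK.toLinearMap πK.injective)
    (VeroneseGrassmann.veroneseVariety (AlgebraicClosure F) 4)
    (Projectivization.map_injective _ _)).trans
      (Equiv.setCongr (hfK.image_veroneseVariety h2K))
  have he : ∀ p, (e p).1 = Projectivization.map πK.toLinearMap πK.injective p.1 := fun _ => rfl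
  exact ⟨VeroneseGrassmann.bivectorEquiv h2 f, πK, e, hf.image_veroneseVariety h2, hext, he,
    VeroneseGrassmann.phiSubset_subset_lineGrassmannian _,
    hext.isVarietyIso (VeroneseGrassmann.veroneseVariety_isAlgebraicSet F) e he⟩
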